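/- Let $\mathfrak H=\{z\in\mathbb C:\operatorname{Im}z>0\}$. For an integer $N\ge 1$ let $\Gamma_0(N)=\left\{\begin{pmatrix}a&b\\c&d\end{pmatrix}\in SL(2,\mathbb Z): c\equiv 0 \pmod N\right\}$, and define the Epstein zeta function $$E^{\Gamma_0(N)}(z,s)=\sum_{\gamma\in\left(\begin{smallmatrix}*&*\\0&*\end{smallmatrix}\right)\backslash\Gamma_0(N)}[\operatorname{Im}(\gamma z)]^{s},\qquad z\in\mathfrak H,\ \operatorname{Re}s>1.$$ For $z=x+iy\in\mathfrak H$, let $\left(\frac{\partial}{\partial y}\frac1y\right)^m$ denote the $m$-fold iterate of the operator $f\mapsto\frac{\partial}{\partial y}\left(\frac{f}{y}\right)$ with $x$ fixed. Let $\zeta$ be the Riemann zeta function. Then for every integer $m\ge 1$ and every $z=x+iy\in\mathfrak H$ the series defining $E^{\Gamma_0(1)}(z,m+1)$ and $E^{\Gamma_0(4)}\left(-\frac1{4z},m+1\right)$ converge absolutely, and the following hold. (a) $$E^{\Gamma_0(1)}(z,m+1)=y^{m+1}+\frac{\sqrt\pi\,\Gamma(m+\frac12)}{\Gamma(m+1)}\frac{\zeta(2m+1)}{\zeta(2m+2)}\frac1{y^m}-\frac{\pi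 y^m}{(-2)^{m-1}\Gamma(m+1)\zeta(2m+2)}\left(\frac{\partial}{\partial y}\frac1y\right)^m\operatorname{Re}\sum_{n=1}^\infty\frac1{n^{2m+1}}\frac1{e^{2n\pi z/i}-1}.$$ (b) $$E^{\Gamma_0(4)}\left(-\frac1{4z},m+1\right)=\frac{2^{2m+1}-1}{2^{2m+2}-1}\,\frac{\sqrt\pi\,\Gamma(m+\frac12)}{2\,\Gamma(m+1)}\,\frac{\zeta(2m+1)}{\zeta(2m+2)}\,\frac1{(4y)^m}+\frac{\pi y^m}{(-2)^{m-1}(2^{2m+2}-1)\Gamma(m+1)\zeta(2m+2)}\left(\frac{\partial}{\partial y}\frac1y\right)^m\operatorname{Re}\sum_{n=0}^\infty\frac1{(2n+1)^{2m+1}}\frac1{e^{(2n+1)\pi(2z+1)/i}+1}.$$ The two series on the right-hand sides converge exponentially fast: as $n\to\infty$ with $z$ and $m$ fixed, their $n$-th terms are $O(e^{-2\pi n y})$ and $O(e^{-2\pi(2n+1)y})$ respectively. For fixed $x$, the real parts of their sums are infinitely differentiable functions of $y\in(0,\infty)$. -/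

import Mathlib

open UpperHalfPlane
open scoped MatrixGroups ContDiff

/-- The subgroup of upper triangular matrices (lower left entry `0`) of `Γ₀(N)`. -/
def upperTriangular (N : ℕ) : Subgroup (CongruenceSubgroup.Gamma0 N) where
  carrier := {γ | (γ : SL(2, ℤ)) 1 0 = 0}
  one_mem' := by simp
  mul_mem' := by
    intro a b ha hb
    simp only [Set.mem_ofPred_eq] at ha hb ⊢
    simp [Matrix.mul_apply, Fin.sum_univ_two, ha, hb]
  inv_mem' := by
    intro a ha
    simp only [Set.mem_ofPred_eq] at ha ⊢
    simp [Matrix.SpecialLinearGroup.SL2_inv_expl, ha]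

/-- An upper triangular matrix in `SL(2, ℤ)` does not change imaginary parts. -/
theorem im_smul_of_lower_left_eq_zero (h : SL(2, ℤ)) (hh : h 1 0 = 0) (w : ℍ) :
    (h • w).im = w.im := by
  have hdet : h 0 0 * h 1 1 = 1 := by
    have := Matrix.det_fin_two (h : Matrix (Fin 2) (Fin 2) ℤ)
    rw [h.det_coe, hh] at this
    linarith
  have h1 : h 1 1 = 1 ∨ h 1 1 = -1 :=
    Int.isUnit_iff.1 (IsUnit.of_mul_eq_one (h 0 0) (by linarith))
  rw [ModularGroup.im_smul_eq_div_normSq, ModularGroup.denom_apply, hh]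
  rcases h1 with h1 | h1 <;> simp [h1]

/-- The coset space `(* * ; 0 *) \ Γ₀(N)`: two matrices are identified when they differ by left
multiplication with an upper triangular matrix. -/
abbrev EpsteinCosets (N : ℕ) : Type :=
  Quotient (QuotientGroup.rightRel (upperTriangular N))

/-- The function `γ ↦ Im (γ z)` on the coset space `(* * ; 0 *) \ Γ₀(N)`. -/
noncomputable def cosetIm (N : ℕ) (z : ℍ) : EpsteinCosets N → ℝ :=
  Quotient.lift (fun γ : CongruenceSubgroup.Gamma0 N => ((γ : SL(2, ℤ)) • z).im) (by
    intro a b hab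
    have hab' : b * a⁻¹ ∈ upperTriangular N := QuotientGroup.rightRel_apply.1 hab
    have key := im_smul_of_lower_left_eq_zero
      ((b * a⁻¹ : CongruenceSubgroup.Gamma0 N) : SL(2, ℤ)) hab' ((a : SL(2, ℤ)) • z)
    rw [← mul_smul] at key
    simpa using key.symm)

/-- The summand `[Im (γ z)] ^ s` of the Epstein zeta function. -/
noncomputable def epsteinTerm (N : ℕ) (z : ℍ) (s : ℂ) (γ : EpsteinCosets N) : ℂ :=
  (cosetIm N z γ : ℂ) ^ s

/-- The Epstein zeta function `E^{Γ₀(N)}(z, s)`, for `Re s > 1`. -/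
noncomputable def epsteinZeta (N : ℕ) (z : ℍ) (s : ℂ) : ℂ :=
  ∑' γ : EpsteinCosets N, epsteinTerm N z s γ

/-- The point `-1 / (4 z)` of the upper half-plane. -/
noncomputable def negInvFourMul (z : ℍ) : ℍ :=
  ⟨-1 / (4 * (z : ℂ)), by
    have hz : 0 < Complex.normSq (z : ℂ) := z.normSq_pos
    have him : 0 < (z : ℂ).im := z.im_pos
    have h4 : (-1 / (4 * (z : ℂ))).im = (z : ℂ).im / (4 * Complex.normSq (z : ℂ)) := by
      have hne := hz.ne'
      rw [Complex.div_im]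
      simp only [Complex.normSq_mul, Complex.mul_im, Complex.mul_re, Complex.neg_im,
        Complex.neg_re, Complex.one_im, Complex.one_re, Complex.normSq_ofNat, Complex.re_ofNat,
        Complex.im_ofNat]
      field_simp
      ring
    rw [h4]
    positivity⟩

/-- The differential operator `f ↦ ∂/∂y (f / y)` in one real variable `y`. -/
noncomputable def derivInv (f : ℝ → ℝ) : ℝ → ℝ :=
  deriv fun y => 1 / y * f y

/-- The `n`-th term (`n ≥ 1`) of the level `1` series:
`n ^ (-2m-1) / (exp (2 n π z / i) - 1)`. -/
noncomputable def ramanujanTermOne (m : ℕ) (z : ℂ) (n : ℕ) : ℂ :=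
  1 / (n : ℂ) ^ (2 * m + 1) * (1 / (Complex.exp (2 * n * Real.pi * (z / Complex.I)) - 1))

/-- The `n`-th term (`n ≥ 0`) of the level `4` series:
`(2n+1) ^ (-2m-1) / (exp ((2n+1) π (2z+1) / i) + 1)`. -/
noncomputable def ramanujanTermFour (m : ℕ) (z : ℂ) (n : ℕ) : ℂ :=
  1 / (2 * n + 1 : ℂ) ^ (2 * m + 1) *
    (1 / (Complex.exp ((2 * n + 1) * Real.pi * ((2 * z + 1) / Complex.I)) + 1))

/-- Real part of the level `1` series (summed over `n ≥ 1`) at `x + i y`, as a function of `y`. -/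
noncomputable def ramanujanSumOne (m : ℕ) (x : ℝ) (y : ℝ) : ℝ :=
  (∑' n : ℕ, ramanujanTermOne m (x + y * Complex.I) (n + 1)).re

/-- Real part of the level `4` series (summed over `n ≥ 0`) at `x + i y`, as a function of `y`. -/
noncomputable def ramanujanSumFour (m : ℕ) (x : ℝ) (y : ℝ) : ℝ :=
  (∑' n : ℕ, ramanujanTermFour m (x + y * Complex.I) n).re

/-! Write `D f = (f / y)'` and, for multipliers `k`, let `H_j(y)` be the sum over `k` and all
integers `d` of `k^(2j-2m) / |kz+d|^(2j+2)` (`latticeSum`). For `j = 0`, the imaginary part of the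
cotangent series evaluates each inner sum, so `y H_0 / π` is `∑ k^(-2m-1)` plus twice the real part
of the Lambert series (`latticeSum_zero`). Differentiation in `y` gives `D (y H_j) = H_j' = -2(j+1)
y H_(j+1)`, hence `D^m (y H_0) = (-2)^m m! y H_m`, while `D^m 1 = (-2)^m Γ(m+1/2) / √π * y^(-2m)`
(`iterate_derivInv_re_tsum_lambertTerm`). At `j = m` the weight is `1`, and `H_m` is a plain lattice
sum of `|kz+d|^(-2m-2)`. On the other side, cosets correspond to coprime bottom rows up to sign.
Multiplying these rows by all admissible `k` turns the Epstein series times `∑ k^(-2m-2)` into a sum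
over lattice vectors (`IsRowSelector.summable_and_tsum_eq`), which is `H_m` up to elementary terms.
Level 1 uses all `k ≥ 1`, level 4 all odd `k ≥ 1`. -/

/-! ### The sum over one lattice row, from the cotangent series. -/

theorem norm_exp_neg_two_pi_I_mul (z : ℂ) :
    ‖Complex.exp (-(2 * Real.pi * Complex.I * z))‖ = Real.exp (2 * Real.pi * z.im) := by
  rw [Complex.norm_exp]
  congr 1
  simp

theorem one_lt_exp_two_pi_mul {y : ℝ} (hy : 0 < y) : 1 < Real.exp (2 * Real.pi * y) :=
  Real.one_lt_exp_iff.2 (by positivity)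

theorem one_sub_exp_pos {y : ℝ} (hy : 0 < y) : 0 < 1 - Real.exp (-(2 * Real.pi * y)) := by
  have := Real.pi_pos
  rw [sub_pos, Real.exp_lt_one_iff, neg_lt_zero]
  positivity

theorem exp_neg_two_pi_I_mul_ne_one {z : ℂ} (hz : 0 < z.im) :
    Complex.exp (-(2 * Real.pi * Complex.I * z)) ≠ 1 := by
  intro h
  have h1 := norm_exp_neg_two_pi_I_mul z
  rw [h, norm_one] at h1
  exact (one_lt_exp_two_pi_mul hz).ne h1

/-- From `|E - 1| ≥ |E| - 1 = |E| (1 - 1/|E|)`. The separate `y` makes the constant uniform when `z`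
runs over the multiples `k z`. -/
theorem norm_one_div_exp_sub_one_le {z : ℂ} {y : ℝ} (hy : 0 < y) (hz : y ≤ z.im) :
    ‖1 / (Complex.exp (-(2 * Real.pi * Complex.I * z)) - 1)‖ ≤
      1 / (1 - Real.exp (-(2 * Real.pi * y))) * Real.exp (-(2 * Real.pi * z.im)) := by
  have h1 := norm_sub_norm_le (Complex.exp (-(2 * Real.pi * Complex.I * z))) 1
  rw [norm_exp_neg_two_pi_I_mul, norm_one] at h1
  have h2 := one_sub_exp_pos hy
  have h3 : Real.exp (-(2 * Real.pi * z.im)) ≤ Real.exp (-(2 * Real.pi * y)) := by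
    apply Real.exp_le_exp.2
    have := Real.pi_pos
    nlinarith
  have h4 : Real.exp (-(2 * Real.pi * z.im)) * Real.exp (2 * Real.pi * z.im) = 1 := by
    rw [← Real.exp_add]; simp
  have h5 := Real.exp_pos (-(2 * Real.pi * z.im))
  have h6 := one_lt_exp_two_pi_mul (hy.trans_le hz)
  rw [norm_div, norm_one, div_mul_eq_mul_div, one_mul,
    div_le_div_iff₀ (by linarith) (by linarith)]
  nlinarith

theorem one_div_normSq_eq_im (w : ℂ) (hw : w.im ≠ 0) :
    1 / Complex.normSq w = -(1 / w).im / w.im := by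
  rw [one_div, one_div, Complex.inv_im]
  field_simp

theorem summable_and_summable_of_nonneg_add {f g : ℕ → ℝ} (hf : 0 ≤ f) (hg : 0 ≤ g)
    (h : Summable fun n => f n + g n) : Summable f ∧ Summable g :=
  ⟨h.of_nonneg_of_le hf fun n => le_add_of_nonneg_right (hg n),
    h.of_nonneg_of_le hg fun n => le_add_of_nonneg_left (hf n)⟩

/-- The sum of `1 / |z + d| ^ 2` over all integers `d`, as an exponential expression. -/
theorem hasSum_one_div_normSq_add_int {z : ℂ} (hz : 0 < z.im) :
    HasSum (fun d : ℤ => 1 / Complex.normSq (z + d))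
      (Real.pi / z.im *
        (1 + 2 * (1 / (Complex.exp (-(2 * Real.pi * Complex.I * z)) - 1)).re)) := by
  have hzc : z ∈ Complex.integerComplement := UpperHalfPlane.coe_mem_integerComplement ⟨z, hz⟩
  have key := ((summable_cotTerm hzc).hasSum)
  rw [show (∑' n, cotTerm z n) = Real.pi * Complex.cot (Real.pi * z) - 1 / z from
    (cot_series_rep' hzc).symm] at key
  -- All `z + d` have the same imaginary part, so `1 / |z+d|^2` is `-Im (1/(z+d))` divided by a
  -- constant.
  have him := Complex.hasSum_im key
  have key2 := (him.neg.div_const z.im)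
  have hterm : ∀ w : ℂ, w.im = z.im → 1 / Complex.normSq w = -(1 / w).im / z.im := by
    intro w hw
    rw [one_div_normSq_eq_im w (by rw [hw]; exact hz.ne'), hw]
  have hfun : (fun n : ℕ => -(cotTerm z n).im / z.im) = fun n : ℕ =>
      1 / Complex.normSq (z + ((-((n : ℤ) + 1) : ℤ) : ℂ)) +
        1 / Complex.normSq (z + (((n : ℤ) + 1 : ℤ) : ℂ)) := by
    funext n
    rw [hterm _ (by simp), hterm _ (by simp)]
    simp only [cotTerm, Complex.add_im]
    push_cast
    rw [← add_div, ← neg_add, ← sub_eq_add_neg]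
  simp only [hfun] at key2
  -- The cotangent series only sums `d` and `-d` in pairs; nonnegativity separates the two halves.
  obtain ⟨s1, s2⟩ := summable_and_summable_of_nonneg_add
    (fun n => one_div_nonneg.2 (Complex.normSq_nonneg _))
    (fun n => one_div_nonneg.2 (Complex.normSq_nonneg _)) key2.summable
  have hs := HasSum.of_add_one_of_neg_add_one
    (f := fun d : ℤ => 1 / Complex.normSq (z + d)) s2.hasSum s1.hasSum
  convert hs using 1
  have e1 := (s1.hasSum.add s2.hasSum).unique key2
  rw [add_right_comm, add_comm (∑' n : ℕ, 1 / Complex.normSq (z + (((n : ℤ) + 1 : ℤ) : ℂ))), e1,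
    hterm _ (by simp)]
  have hne := exp_neg_two_pi_I_mul_ne_one hz
  have hcot : (Real.pi * Complex.cot (Real.pi * z) : ℂ) = -(Real.pi * Complex.I) *
      (1 + 2 * (1 / (Complex.exp (-(2 * Real.pi * Complex.I * z)) - 1))) := by
    rw [Complex.cot_pi_eq_exp_ratio]
    have hq : Complex.exp (2 * Real.pi * Complex.I * z) =
        (Complex.exp (-(2 * Real.pi * Complex.I * z)))⁻¹ := by
      rw [Complex.exp_neg, inv_inv]
    rw [hq]
    generalize hE : Complex.exp (-(2 * Real.pi * Complex.I * z)) = E at hne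
    have hE0 : E ≠ 0 := hE ▸ Complex.exp_ne_zero _
    have h1 : E - 1 ≠ 0 := sub_ne_zero.2 hne
    have hI := Complex.I_mul_I
    have h2 : (1 - E⁻¹) ≠ 0 := by
      rw [sub_ne_zero]; exact fun h => hne (by rw [← inv_inv E, ← h, inv_one])
    have hI0 := Complex.I_ne_zero
    have h3 : E⁻¹ + 1 = (E + 1) / E := by field_simp; ring
    have h4 : 1 - E⁻¹ = (E - 1) / E := by field_simp
    rw [h3, h4]
    field_simp
    rw [Complex.I_sq]
    ring
  rw [hcot]
  have him2 : ∀ w : ℂ, (-(Real.pi * Complex.I) * (1 + 2 * w)).im = -Real.pi * (1 + 2 * w.re) := by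
    intro w; simp
  rw [Complex.sub_im, him2]
  simp only [Int.cast_zero, add_zero]
  field_simp
  ring

/-! ### Lattice sums and Lambert series. -/

/-- The summand `k ^ (2 j - 2 m) / |k z + d| ^ (2 (j + 1))` at `z = x + i y`, with `k = k n`. -/
noncomputable def latticeTerm (k : ℕ → ℕ) (m : ℕ) (x : ℝ) (j : ℕ) (p : ℕ × ℤ) (y : ℝ) : ℝ :=
  (k p.1 : ℝ) ^ (2 * j) / (k p.1 : ℝ) ^ (2 * m) *
    (1 / ((k p.1 * x + p.2) ^ 2 + (k p.1 * y) ^ 2) ^ (j + 1))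

/-- The sum of `latticeTerm` over all `n` and `d`. -/
noncomputable def latticeSum (k : ℕ → ℕ) (m : ℕ) (x : ℝ) (j : ℕ) (y : ℝ) : ℝ :=
  ∑' p, latticeTerm k m x j p y

/-- The Lambert type summand `k ^ (-2m-1) / (exp (-2 π i k z) - 1)` with `k = k n`. -/
noncomputable def lambertTerm (k : ℕ → ℕ) (m : ℕ) (z : ℂ) (n : ℕ) : ℂ :=
  1 / (k n : ℂ) ^ (2 * m + 1) *
    (1 / (Complex.exp (-(2 * Real.pi * Complex.I * (k n * z))) - 1))

/-- The hypothesis `n + 1 ≤ k n` covers both `k n = n + 1` and `k n = 2 n + 1`; it gives positivity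
and domination by a zeta series. -/
theorem latticeIndex_pos {k : ℕ → ℕ} (hk : ∀ n, n + 1 ≤ k n) (n : ℕ) : (0 : ℝ) < k n := by
  exact_mod_cast (Nat.succ_pos n).trans_le (hk n)

theorem summable_one_div_latticeIndex_pow {k : ℕ → ℕ} (hk : ∀ n, n + 1 ≤ k n) {s : ℕ} (hs : 2 ≤ s) :
    Summable fun n => 1 / (k n : ℝ) ^ s := by
  have h : Summable fun n : ℕ => 1 / ((n + 1 : ℕ) : ℝ) ^ s :=
    (summable_nat_add_iff 1).2 (Real.summable_one_div_nat_pow.2 (by omega))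
  refine h.of_nonneg_of_le (fun n => by positivity) fun n => ?_
  apply one_div_le_one_div_of_le (by positivity)
  gcongr
  exact hk n

theorem natCast_mul_im (n : ℕ) (z : ℂ) : ((n : ℂ) * z).im = n * z.im := by
  simp

theorem im_latticeIndex_mul_le {k : ℕ → ℕ} (hk : ∀ n, n + 1 ≤ k n) {z : ℂ} (hz : 0 < z.im) (n : ℕ) : z.im ≤ ((k n : ℂ) * z).im := by
  have h : (1 : ℝ) ≤ k n := by exact_mod_cast (Nat.le_add_left 1 n).trans (hk n)
  rw [natCast_mul_im]
  nlinarith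

theorem norm_lambertTerm_le {k : ℕ → ℕ} (hk : ∀ n, n + 1 ≤ k n) {m : ℕ} {z : ℂ} (hz : 0 < z.im) (n : ℕ) :
    ‖lambertTerm k m z n‖ ≤ 1 / (k n : ℝ) ^ (2 * m + 1) *
      (1 / (1 - Real.exp (-(2 * Real.pi * z.im))) * Real.exp (-(2 * Real.pi * (k n * z.im)))) := by
  have h := norm_one_div_exp_sub_one_le hz (im_latticeIndex_mul_le hk hz n)
  rw [natCast_mul_im] at h
  rw [lambertTerm, norm_mul, norm_div, norm_one, norm_pow, Complex.norm_natCast]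
  gcongr

theorem norm_lambertTerm_le_exp {k : ℕ → ℕ} (hk : ∀ n, n + 1 ≤ k n) {m : ℕ} {z : ℂ} (hz : 0 < z.im) (n : ℕ) :
    ‖lambertTerm k m z n‖ ≤ 1 / (1 - Real.exp (-(2 * Real.pi * z.im))) *
      Real.exp (-(2 * Real.pi * (k n * z.im))) := by
  refine (norm_lambertTerm_le hk hz n).trans (mul_le_of_le_one_left ?_ ?_)
  · have := one_sub_exp_pos hz
    positivity
  · have h : (1 : ℝ) ≤ k n := by exact_mod_cast (Nat.le_add_left 1 n).trans (hk n)
    exact div_le_one_of_le₀ (one_le_pow₀ h) (by positivity)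

theorem summable_lambertTerm {k : ℕ → ℕ} (hk : ∀ n, n + 1 ≤ k n) {m : ℕ} (hm : 1 ≤ m)
    {z : ℂ} (hz : 0 < z.im) : Summable (lambertTerm k m z) := by
  refine Summable.of_norm_bounded ((summable_one_div_latticeIndex_pow hk
    (s := 2 * m + 1) (by omega)).mul_right (1 / (1 - Real.exp (-(2 * Real.pi * z.im)))))
    fun n => (norm_lambertTerm_le hk hz n).trans ?_
  have h0 := one_sub_exp_pos hz
  have h1 := latticeIndex_pos hk n
  gcongr
  apply mul_le_of_le_one_right (by positivity)
  rw [Real.exp_le_one_iff, neg_nonpos]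
  have := Real.pi_pos
  positivity

theorem latticeTerm_nonneg {k : ℕ → ℕ} {m : ℕ} (x : ℝ) (j : ℕ) (p : ℕ × ℤ) (y : ℝ) : 0 ≤ latticeTerm k m x j p y := by
  rw [latticeTerm]; positivity

theorem hasSum_latticeTerm_zero_row {k : ℕ → ℕ} (hk : ∀ n, n + 1 ≤ k n) {m : ℕ}
    (x : ℝ) {y : ℝ} (hy : 0 < y) (n : ℕ) :
    HasSum (fun d : ℤ => latticeTerm k m x 0 (n, d) y)
      (Real.pi / y * (1 / (k n : ℝ) ^ (2 * m + 1) +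
        2 * (lambertTerm k m (x + y * Complex.I) n).re)) := by
  have hkn := latticeIndex_pos hk n
  have him : ((k n : ℂ) * (x + y * Complex.I)).im = k n * y := by
    rw [natCast_mul_im]; simp
  have h := hasSum_one_div_normSq_add_int (z := (k n : ℂ) * (x + y * Complex.I))
    (by rw [him]; positivity)
  have h2 := h.mul_left (1 / (k n : ℝ) ^ (2 * m))
  have hf : (fun d : ℤ => latticeTerm k m x 0 (n, d) y) = fun d : ℤ => 1 / (k n : ℝ) ^ (2 * m) *
      (1 / Complex.normSq ((k n : ℂ) * (x + y * Complex.I) + d)) := by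
    funext d
    rw [latticeTerm, Complex.normSq_apply]
    simp [sq]
  have hv : Real.pi / y * (1 / (k n : ℝ) ^ (2 * m + 1) +
      2 * (lambertTerm k m (x + y * Complex.I) n).re) = 1 / (k n : ℝ) ^ (2 * m) *
      (Real.pi / (k n * y) * (1 + 2 * (1 / (Complex.exp (-(2 * Real.pi * Complex.I *
        (k n * (x + y * Complex.I)))) - 1)).re)) := by
    rw [lambertTerm, ← Complex.ofReal_natCast, ← Complex.ofReal_pow, ← Complex.ofReal_one,
      ← Complex.ofReal_div, Complex.re_ofReal_mul]
    field_simp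
    ring
  rw [him] at h2
  rw [hf, hv]
  exact h2

/-- The terms are nonnegative, so summability of the explicit row sums suffices. -/
theorem summable_latticeTerm_zero {k : ℕ → ℕ} (hk : ∀ n, n + 1 ≤ k n) {m : ℕ} (hm : 1 ≤ m)
    (x : ℝ) {y : ℝ} (hy : 0 < y) :
    Summable fun p => latticeTerm k m x 0 p y := by
  refine (summable_prod_of_nonneg fun p => latticeTerm_nonneg x 0 p y).2
    ⟨fun n => (hasSum_latticeTerm_zero_row hk x hy n).summable, ?_⟩
  simp_rw [fun n => (hasSum_latticeTerm_zero_row hk (m := m) x hy n).tsum_eq]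
  have h := Complex.hasSum_re
    (summable_lambertTerm hk hm (z := x + y * Complex.I) (by simpa using hy)).hasSum
  exact (((summable_one_div_latticeIndex_pow hk (by omega)).add
    (h.summable.mul_left 2)).mul_left _)

theorem latticeSum_zero {k : ℕ → ℕ} (hk : ∀ n, n + 1 ≤ k n) {m : ℕ} (hm : 1 ≤ m)
    (x : ℝ) {y : ℝ} (hy : 0 < y) :
    latticeSum k m x 0 y = Real.pi / y * (∑' n, 1 / (k n : ℝ) ^ (2 * m + 1) +
      2 * (∑' n, lambertTerm k m (x + y * Complex.I) n).re) := by
  have h := Complex.hasSum_re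
    (summable_lambertTerm hk hm (z := x + y * Complex.I) (by simpa using hy)).hasSum
  have h2 := ((summable_one_div_latticeIndex_pow hk (s := 2 * m + 1) (by omega)).hasSum.add
    (h.mul_left 2)).mul_left (Real.pi / y)
  exact ((summable_latticeTerm_zero hk hm x hy).hasSum.prod_fiberwise
    fun n => hasSum_latticeTerm_zero_row hk x hy n).unique h2

/-- Since `|kz+d| ≥ k y`, the extra factor `k^(2j) / |kz+d|^(2j)` is at most `y^(-2j)`, which
reduces to `j = 0`. -/
theorem summable_latticeTerm {k : ℕ → ℕ} (hk : ∀ n, n + 1 ≤ k n) {m : ℕ} (hm : 1 ≤ m)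
    (x : ℝ) (j : ℕ) {y : ℝ} (hy : 0 < y) :
    Summable fun p => latticeTerm k m x j p y := by
  refine ((summable_latticeTerm_zero hk hm x hy).mul_left (1 / y ^ (2 * j))).of_nonneg_of_le
    (fun p => latticeTerm_nonneg x j p y) fun p => ?_
  have hkn := latticeIndex_pos hk p.1
  simp only [latticeTerm]
  set A : ℝ := (k p.1 * x + p.2) ^ 2 + (k p.1 * y) ^ 2 with hA
  have hA0 : (k p.1 * y) ^ 2 ≤ A := le_add_of_nonneg_left (sq_nonneg _)
  have hApos : 0 < A := lt_of_lt_of_le (by positivity) hA0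
  have hpow : (k p.1 : ℝ) ^ (2 * j) * y ^ (2 * j) ≤ A ^ j := by
    rw [← mul_pow, pow_mul]; gcongr
  rw [mul_zero, pow_zero, zero_add, pow_one, pow_succ]
  rw [show (k p.1 : ℝ) ^ (2 * j) / (k p.1 : ℝ) ^ (2 * m) * (1 / (A ^ j * A)) =
    ((k p.1 : ℝ) ^ (2 * j) / A ^ j) * (1 / (k p.1 : ℝ) ^ (2 * m) * (1 / A)) by field_simp]
  gcongr ?_ * _
  rw [div_le_div_iff₀ (by positivity) (by positivity), one_mul]
  exact hpow

/-! ### Differentiation in `y`. -/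

/-- The inner derivative `2 k^2 y` supplies the `k^2` by which the weight grows from `j` to `j + 1`.
-/
theorem hasDerivAt_latticeTerm {k : ℕ → ℕ} (hk : ∀ n, n + 1 ≤ k n) {m : ℕ}
    (x : ℝ) (j : ℕ) (p : ℕ × ℤ) {y : ℝ} (hy : 0 < y) :
    HasDerivAt (latticeTerm k m x j p) (-(2 * (j + 1) * y) * latticeTerm k m x (j + 1) p y) y := by
  have hkn := latticeIndex_pos hk p.1
  have hApos : 0 < (k p.1 * x + p.2) ^ 2 + (k p.1 * y) ^ 2 := by positivity
  have h1 : HasDerivAt (fun y : ℝ => (k p.1 * x + p.2) ^ 2 + (k p.1 * y) ^ 2)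
      (2 * (k p.1 * y) * k p.1) y := by
    have := (((hasDerivAt_id y).const_mul (k p.1 : ℝ)).pow 2).const_add
      ((k p.1 * x + p.2 : ℝ) ^ 2)
    simpa using this
  have h2 := ((h1.pow (j + 1)).inv (pow_pos hApos _).ne').const_mul
    ((k p.1 : ℝ) ^ (2 * j) / (k p.1 : ℝ) ^ (2 * m))
  have hfun : latticeTerm k m x j p = fun y => (k p.1 : ℝ) ^ (2 * j) / (k p.1 : ℝ) ^ (2 * m) *
      ((fun y : ℝ => (k p.1 * x + p.2) ^ 2 + (k p.1 * y) ^ 2) ^ (j + 1))⁻¹ y := by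
    funext y
    simp [latticeTerm]
  rw [hfun]
  refine h2.congr_deriv ?_
  simp only [latticeTerm, Pi.pow_apply]
  generalize (k p.1 * x + p.2) ^ 2 + (k p.1 * y) ^ 2 = A at hApos
  push_cast
  field_simp
  ring

theorem hasDerivAt_latticeSum {k : ℕ → ℕ} (hk : ∀ n, n + 1 ≤ k n) {m : ℕ} (hm : 1 ≤ m)
    (x : ℝ) (j : ℕ) {y : ℝ} (hy : 0 < y) :
    HasDerivAt (latticeSum k m x j) (-(2 * (j + 1) * y) * latticeSum k m x (j + 1) y) y := by
  have hmem : y ∈ Set.Ioo (y / 2) (2 * y) := ⟨by linarith, by linarith⟩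
  have hpos : ∀ w ∈ Set.Ioo (y / 2) (2 * y), 0 < w := fun w hw => by linarith [hw.1]
  -- The terms decrease in `y`, so on `(y/2, 2y)` their values at `y/2` give a summable majorant of
  -- the derivatives.
  have h := hasDerivAt_tsum_of_isPreconnected
    (u := fun p => 2 * (j + 1) * (2 * y) * latticeTerm k m x (j + 1) p (y / 2))
    (g := latticeTerm k m x j)
    (g' := fun p w => -(2 * (j + 1) * w) * latticeTerm k m x (j + 1) p w)
    (((summable_latticeTerm hk hm x (j + 1) (half_pos hy))).mul_left _)
    isOpen_Ioo isPreconnected_Ioo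
    (fun p w hw => hasDerivAt_latticeTerm hk x j p (hpos w hw)) ?_ hmem
    (summable_latticeTerm hk hm x j hy) hmem
  · rw [tsum_mul_left] at h
    exact h
  · intro p w hw
    have hw0 := hpos w hw
    have hkn := latticeIndex_pos hk p.1
    rw [norm_mul, Real.norm_of_nonneg (latticeTerm_nonneg x _ p w), norm_neg,
      Real.norm_of_nonneg (by positivity)]
    have h1 : latticeTerm k m x (j + 1) p w ≤ latticeTerm k m x (j + 1) p (y / 2) := by
      simp only [latticeTerm]
      have := hw.1
      gcongr
    have h2 := latticeTerm_nonneg (k := k) (m := m) x (j + 1) p w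
    have := hw.2
    gcongr

/-- The derivative is a polynomial in `y` times the sum for `j + 1`, so the order of smoothness
rises by induction for all `j` at once. -/
theorem contDiffOn_latticeSum {k : ℕ → ℕ} (hk : ∀ n, n + 1 ≤ k n) {m : ℕ} (hm : 1 ≤ m)
    (x : ℝ) (j : ℕ) :
    ContDiffOn ℝ ∞ (latticeSum k m x j) (Set.Ioi 0) := by
  refine contDiffOn_infty.2 fun n => ?_
  induction n generalizing j with
  | zero =>
    exact contDiffOn_zero.2 fun y hy =>
      (hasDerivAt_latticeSum hk hm x j hy).continuousAt.continuousWithinAt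
  | succ n ih =>
    change ContDiffOn ℝ ((n : WithTop ℕ∞) + 1) _ _
    refine (contDiffOn_succ_iff_deriv_of_isOpen isOpen_Ioi).2
      ⟨fun y hy => (hasDerivAt_latticeSum hk hm x j hy).differentiableAt.differentiableWithinAt,
        fun h => absurd h (by simp), ?_⟩
    refine ContDiffOn.congr (f := fun y => -(2 * (j + 1) * y) * latticeSum k m x (j + 1) y) ?_
      fun y hy => (hasDerivAt_latticeSum hk hm x j hy).deriv
    exact ContDiffOn.mul (by fun_prop) (ih (j + 1))

theorem re_tsum_lambertTerm {k : ℕ → ℕ} (hk : ∀ n, n + 1 ≤ k n) {m : ℕ} (hm : 1 ≤ m)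
    (x : ℝ) {y : ℝ} (hy : 0 < y) :
    (∑' n, lambertTerm k m (x + y * Complex.I) n).re =
      (y / Real.pi * latticeSum k m x 0 y - ∑' n, 1 / (k n : ℝ) ^ (2 * m + 1)) / 2 := by
  have := Real.pi_pos
  rw [latticeSum_zero hk hm x hy]
  field_simp
  ring

theorem contDiffOn_re_tsum_lambertTerm {k : ℕ → ℕ} (hk : ∀ n, n + 1 ≤ k n) {m : ℕ} (hm : 1 ≤ m)
    (x : ℝ) :
    ContDiffOn ℝ ∞ (fun y : ℝ => (∑' n, lambertTerm k m (x + y * Complex.I) n).re)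
      (Set.Ioi 0) := by
  refine ContDiffOn.congr ?_ fun y hy => re_tsum_lambertTerm hk hm x hy
  exact (((contDiffOn_id.div_const _).mul (contDiffOn_latticeSum hk hm x 0)).sub
    contDiffOn_const).div_const _

/-- The iterates of `f ↦ (f / y)'` on the real part of the Lambert series. -/
theorem iterate_derivInv_re_tsum_lambertTerm {k : ℕ → ℕ} (hk : ∀ n, n + 1 ≤ k n) {m : ℕ} (hm : 1 ≤ m)
    (x : ℝ) (j : ℕ) {y : ℝ} (hy : 0 < y) :
    derivInv^[j] (fun y : ℝ => (∑' n, lambertTerm k m (x + y * Complex.I) n).re) y =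
      ((-2) ^ j * j.factorial * (y / Real.pi) * latticeSum k m x j y -
        (∑' n, 1 / (k n : ℝ) ^ (2 * m + 1)) *
          ((-2) ^ j * (Real.Gamma (j + 1 / 2) / √Real.pi) * (1 / y ^ (2 * j)))) / 2 := by
  induction j generalizing y with
  | zero =>
    rw [Function.iterate_zero, id_eq, re_tsum_lambertTerm hk hm x hy]
    have h : √Real.pi ≠ 0 := by positivity
    simp only [pow_zero, Nat.factorial_zero, Nat.cast_zero, zero_add, mul_zero,
      Real.Gamma_one_half_eq, div_self h]
    norm_num
  | succ j ih =>
    have hπ := Real.pi_pos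
    rw [Function.iterate_succ_apply', derivInv]
    set Z := ∑' n, 1 / (k n : ℝ) ^ (2 * m + 1)
    set G := Real.Gamma (j + 1 / 2) with hG
    -- Differentiating `y^(-(2j+1))` yields `-(2j+1) = -2 (j + 1/2)`, exactly the Gamma recursion.
    have hG' : Real.Gamma ((j + 1 : ℕ) + 1 / 2) = (j + 1 / 2) * G := by
      rw [hG, ← Real.Gamma_add_one (by positivity)]
      push_cast
      ring_nf
    -- Division by `y` cancels the prefactor of `latticeSum`, so no product rule is needed.
    have hev : (fun y => 1 / y *
        derivInv^[j] (fun y : ℝ => (∑' n, lambertTerm k m (x + y * Complex.I) n).re) y)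
        =ᶠ[nhds y] fun y => ((-2) ^ j * j.factorial / Real.pi * latticeSum k m x j y -
          Z * ((-2) ^ j * (G / √Real.pi)) * (y ^ (2 * j + 1))⁻¹) / 2 := by
      filter_upwards [Ioi_mem_nhds hy] with w hw
      have hw0 : w ≠ 0 := ne_of_gt hw
      rw [ih hw]
      field_simp
      ring
    rw [hev.deriv_eq]
    have hd := ((((hasDerivAt_latticeSum hk hm x j hy).const_mul
      ((-2) ^ j * j.factorial / Real.pi)).sub
      (((hasDerivAt_pow (2 * j + 1) y).inv (by positivity)).const_mul
        (Z * ((-2) ^ j * (G / √Real.pi))))).div_const 2)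
    refine hd.deriv.trans ?_
    rw [hG', Nat.factorial_succ]
    push_cast
    field_simp
    ring

/-! ### Cosets, coprime rows and lattice vectors. -/

/-- `Q` selects, from every pair `±(c, d)` of coprime bottom rows of `Γ₀(N)`, exactly one, and is
satisfied by a positive multiple of a coprime row exactly if the row satisfies it and the factor is
a value of `k`. -/
structure IsRowSelector (N : ℕ) (k : ℕ → ℕ) (Q : ℤ × ℤ → Prop) : Prop where
  dvd : ∀ v, Q v → (N : ℤ) ∣ v.1
  or_neg : ∀ v : ℤ × ℤ, IsCoprime v.1 v.2 → (N : ℤ) ∣ v.1 → Q v ∨ Q (-v)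
  not_neg : ∀ v, Q v → ¬ Q (-v)
  mul_iff : ∀ (g : ℕ) (v : ℤ × ℤ), 0 < g → IsCoprime v.1 v.2 →
    (Q (g * v.1, g * v.2) ↔ g ∈ Set.range k ∧ Q v)

theorem cosetIm_mk (N : ℕ) (z : ℍ) (γ : CongruenceSubgroup.Gamma0 N) :
    cosetIm N z (Quotient.mk _ γ) = z.im /
      Complex.normSq (((γ : SL(2, ℤ)) 1 0 : ℂ) * z + ((γ : SL(2, ℤ)) 1 1 : ℂ)) := by
  change ((γ : SL(2, ℤ)) • z).im = _
  rw [ModularGroup.im_smul_eq_div_normSq, ModularGroup.denom_apply]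

theorem SL2_eq_one_or_neg_one_of_lower_left_eq_zero {h : SL(2, ℤ)} (hh : h 1 0 = 0) :
    h 1 1 = 1 ∨ h 1 1 = -1 := by
  have hdet : h 0 0 * h 1 1 = 1 := by
    have := Matrix.det_fin_two (h : Matrix (Fin 2) (Fin 2) ℤ)
    rw [h.det_coe, hh] at this
    linarith
  exact Int.isUnit_iff.1 (IsUnit.of_mul_eq_one (h 0 0) (by linarith))

/-- An upper triangular integral matrix of determinant `1` has diagonal `±(1, 1)`, so it acts on
bottom rows by a sign. -/
theorem exists_upperTriangular_mul_eq {N : ℕ} (a b : CongruenceSubgroup.Gamma0 N)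
    (h : (Quotient.mk _ a : EpsteinCosets N) = Quotient.mk _ b) :
    ((b : SL(2, ℤ)) 1 0 = (a : SL(2, ℤ)) 1 0 ∧ (b : SL(2, ℤ)) 1 1 = (a : SL(2, ℤ)) 1 1) ∨
    ((b : SL(2, ℤ)) 1 0 = -(a : SL(2, ℤ)) 1 0 ∧ (b : SL(2, ℤ)) 1 1 = -(a : SL(2, ℤ)) 1 1) := by
  have hab : b * a⁻¹ ∈ upperTriangular N := QuotientGroup.rightRel_apply.1 (Quotient.exact h)
  obtain ⟨t, ht⟩ : ∃ t : SL(2, ℤ), t = ((b * a⁻¹ : CongruenceSubgroup.Gamma0 N) : SL(2, ℤ)) :=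
    ⟨_, rfl⟩
  have ht0 : t 1 0 = 0 := ht ▸ hab
  have hb : (b : SL(2, ℤ)) = t * (a : SL(2, ℤ)) := by rw [ht]; simp
  rw [hb]
  rcases SL2_eq_one_or_neg_one_of_lower_left_eq_zero ht0 with h1 | h1
  · left; simp [Matrix.mul_apply, Fin.sum_univ_two, ht0, h1]
  · right; simp [Matrix.mul_apply, Fin.sum_univ_two, ht0, h1]

/-- This entry is, up to sign, the determinant of the two bottom rows, so it vanishes for equal or
opposite rows. -/
theorem SL2_mul_inv_lower_left (a b : SL(2, ℤ)) :
    (b * a⁻¹) 1 0 = b 1 0 * a 1 1 - b 1 1 * a 1 0 := by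
  rw [Matrix.SpecialLinearGroup.coe_mul, Matrix.mul_apply, Fin.sum_univ_two,
    Matrix.SpecialLinearGroup.coe_inv, Matrix.adjugate_fin_two]
  simp
  ring

theorem mk_eq_mk_of_row_eq {N : ℕ} (a b : CongruenceSubgroup.Gamma0 N)
    (h0 : (b : SL(2, ℤ)) 1 0 = (a : SL(2, ℤ)) 1 0)
    (h1 : (b : SL(2, ℤ)) 1 1 = (a : SL(2, ℤ)) 1 1) :
    (Quotient.mk _ a : EpsteinCosets N) = Quotient.mk _ b := by
  refine Quotient.sound (QuotientGroup.rightRel_apply.2 ?_)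
  change ((b * a⁻¹ : CongruenceSubgroup.Gamma0 N) : SL(2, ℤ)) 1 0 = 0
  rw [Subgroup.coe_mul, Subgroup.coe_inv, SL2_mul_inv_lower_left, h0, h1]
  ring

theorem mk_eq_mk_of_row_eq_neg {N : ℕ} (a b : CongruenceSubgroup.Gamma0 N)
    (h0 : (b : SL(2, ℤ)) 1 0 = -(a : SL(2, ℤ)) 1 0)
    (h1 : (b : SL(2, ℤ)) 1 1 = -(a : SL(2, ℤ)) 1 1) :
    (Quotient.mk _ a : EpsteinCosets N) = Quotient.mk _ b := by
  refine Quotient.sound (QuotientGroup.rightRel_apply.2 ?_)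
  change ((b * a⁻¹ : CongruenceSubgroup.Gamma0 N) : SL(2, ℤ)) 1 0 = 0
  rw [Subgroup.coe_mul, Subgroup.coe_inv, SL2_mul_inv_lower_left, h0, h1]
  ring

/-- Selected coprime rows are representatives of the cosets. -/
theorem IsRowSelector.exists_equiv {N : ℕ} {k : ℕ → ℕ} {Q : ℤ × ℤ → Prop}
    (hQ : IsRowSelector N k Q) (z : ℍ) :
    ∃ e : {v : ℤ × ℤ // IsCoprime v.1 v.2 ∧ Q v} ≃ EpsteinCosets N,
      ∀ v, cosetIm N z (e v) = z.im / Complex.normSq ((v.1.1 : ℂ) * z + (v.1.2 : ℂ)) := by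
  have hex : ∀ v : {v : ℤ × ℤ // IsCoprime v.1 v.2 ∧ Q v}, ∃ γ : CongruenceSubgroup.Gamma0 N,
      (γ : SL(2, ℤ)) 1 0 = v.1.1 ∧ (γ : SL(2, ℤ)) 1 1 = v.1.2 := by
    intro v
    obtain ⟨g, hg0, hg1⟩ := v.2.1.exists_SL2_row 1
    refine ⟨⟨g, ?_⟩, hg0, hg1⟩
    rw [CongruenceSubgroup.Gamma0_mem, hg0, ZMod.intCast_zmod_eq_zero_iff_dvd]
    exact hQ.dvd _ v.2.2
  choose γ hγ using hex
  have hbij : Function.Bijective fun v => (Quotient.mk _ (γ v) : EpsteinCosets N) := by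
    constructor
    · intro v w hvw
      have h := exists_upperTriangular_mul_eq _ _ hvw
      rw [(hγ v).1, (hγ v).2, (hγ w).1, (hγ w).2] at h
      rcases h with ⟨h0, h1⟩ | ⟨h0, h1⟩
      · exact Subtype.ext (Prod.ext h0.symm h1.symm)
      · have h2 : w.1 = -v.1 := Prod.ext h0 h1
        exact absurd (h2 ▸ w.2.2) (hQ.not_neg _ v.2.2)
    · intro q
      induction q using Quotient.inductionOn with
      | h b =>
        have hcop : IsCoprime ((b : SL(2, ℤ)) 1 0) ((b : SL(2, ℤ)) 1 1) := by
          have := Matrix.det_fin_two ((b : SL(2, ℤ)) : Matrix (Fin 2) (Fin 2) ℤ)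
          rw [(b : SL(2, ℤ)).det_coe] at this
          exact ⟨-(b : SL(2, ℤ)) 0 1, (b : SL(2, ℤ)) 0 0, by linarith⟩
        have hdvd : (N : ℤ) ∣ (b : SL(2, ℤ)) 1 0 := by
          rw [← ZMod.intCast_zmod_eq_zero_iff_dvd]
          exact CongruenceSubgroup.Gamma0_mem.1 b.2
        rcases hQ.or_neg ((b : SL(2, ℤ)) 1 0, (b : SL(2, ℤ)) 1 1) hcop hdvd with h | h
        · refine ⟨⟨_, hcop, h⟩, mk_eq_mk_of_row_eq _ _ ?_ ?_⟩
          · rw [(hγ _).1]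
          · rw [(hγ _).2]
        · refine ⟨⟨_, hcop.neg_neg, h⟩, mk_eq_mk_of_row_eq_neg _ _ ?_ ?_⟩
          · rw [(hγ _).1]; simp
          · rw [(hγ _).2]; simp
  refine ⟨Equiv.ofBijective _ hbij, fun v => ?_⟩
  rw [Equiv.ofBijective_apply, cosetIm_mk, (hγ v).1, (hγ v).2]

/-- A nonzero integer vector is uniquely its gcd times a coprime vector; `mul_iff` says which gcds
occur. -/
theorem IsRowSelector.bijective_mul {N : ℕ} {k : ℕ → ℕ} {Q : ℤ × ℤ → Prop}
    (hQ : IsRowSelector N k Q) (hk : ∀ n, n + 1 ≤ k n) (hinj : Function.Injective k) :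
    Function.Bijective fun p : ℕ × {v : ℤ × ℤ // IsCoprime v.1 v.2 ∧ Q v} =>
      (⟨((k p.1 : ℤ) * p.2.1.1, (k p.1 : ℤ) * p.2.1.2),
        (hQ.mul_iff _ _ ((Nat.succ_pos _).trans_le (hk _)) p.2.2.1).2 ⟨Set.mem_range_self _, p.2.2.2⟩⟩ :
        {w // Q w}) := by
  constructor
  · rintro ⟨n, ⟨v1, v2⟩, hv, hv'⟩ ⟨n', ⟨w1, w2⟩, hw, hw'⟩ h
    simp only [Subtype.mk.injEq, Prod.mk.injEq] at h
    have hg : ∀ (a : ℕ) (b c : ℤ), IsCoprime b c → Int.gcd (a * b) (a * c) = a := by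
      intro a b c hbc
      rw [Int.gcd_mul_left, Int.isCoprime_iff_gcd_eq_one.1 hbc]
      simp
    have hkk : k n = k n' := by
      rw [← hg (k n) _ _ hv, ← hg (k n') _ _ hw, h.1, h.2]
    have hn := hinj hkk
    subst hn
    have hk0 : (k n : ℤ) ≠ 0 := by
      have := hk n
      omega
    have e1 := mul_left_cancel₀ hk0 h.1
    have e2 := mul_left_cancel₀ hk0 h.2
    subst e1 e2
    rfl
  · rintro ⟨⟨w1, w2⟩, hw⟩
    have hne : 0 < Int.gcd w1 w2 := by
      rw [Int.gcd_pos_iff]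
      by_contra! h
      obtain ⟨h1, h2⟩ := h
      subst h1 h2
      -- The zero vector equals its negative, so `Q` cannot select it.
      exact hQ.not_neg _ hw (by simpa using hw)
    obtain ⟨a, b, hab, h1, h2⟩ : ∃ a b : ℤ, IsCoprime a b ∧ w1 = Int.gcd w1 w2 * a ∧
        w2 = Int.gcd w1 w2 * b := by
      obtain ⟨a, b, hab, h1, h2⟩ := Int.exists_gcd_one hne
      exact ⟨a, b, Int.isCoprime_iff_gcd_eq_one.2 hab, by rw [mul_comm]; exact h1,
        by rw [mul_comm]; exact h2⟩
    generalize Int.gcd w1 w2 = g at hne h1 h2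
    subst h1 h2
    obtain ⟨⟨n, hn⟩, hv⟩ := (hQ.mul_iff g (a, b) hne hab).1 hw
    refine ⟨(n, ⟨(a, b), hab, hv⟩), ?_⟩
    simp [hn]

/-- The lattice sum over all selected rows is a zeta factor times the Epstein zeta function. -/
theorem IsRowSelector.summable_and_tsum_eq {N : ℕ} {k : ℕ → ℕ} {Q : ℤ × ℤ → Prop}
    (hQ : IsRowSelector N k Q) (hk : ∀ n, n + 1 ≤ k n) (hinj : Function.Injective k) (z : ℍ)
    (s : ℕ) (hs : 1 ≤ s) {S : ℝ}
    (hsum : HasSum (fun w : {w // Q w} =>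
      (z.im / Complex.normSq ((w.1.1 : ℂ) * z + (w.1.2 : ℂ))) ^ s) S) :
    Summable (fun γ => cosetIm N z γ ^ s) ∧
      S = (∑' n, 1 / (k n : ℝ) ^ (2 * s)) * ∑' γ, cosetIm N z γ ^ s := by
  obtain ⟨e, he⟩ := hQ.exists_equiv z
  have h1 := (Equiv.ofBijective _ (hQ.bijective_mul hk hinj)).hasSum_iff.2 hsum
  have hf : ((fun w : {w // Q w} =>
      (z.im / Complex.normSq ((w.1.1 : ℂ) * z + (w.1.2 : ℂ))) ^ s) ∘
      Equiv.ofBijective _ (hQ.bijective_mul hk hinj)) =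
      fun p : ℕ × {v : ℤ × ℤ // IsCoprime v.1 v.2 ∧ Q v} => 1 / (k p.1 : ℝ) ^ (2 * s) * (cosetIm N z (e p.2)) ^ s := by
    funext p
    change (z.im / Complex.normSq ((((k p.1 : ℤ) * p.2.1.1 : ℤ) : ℂ) * z +
      (((k p.1 : ℤ) * p.2.1.2 : ℤ) : ℂ))) ^ s = _
    rw [he]
    push_cast
    rw [mul_assoc, ← mul_add, Complex.normSq_mul, Complex.normSq_natCast, pow_mul, ← one_div_pow,
      ← mul_pow]
    congr 1
    rw [sq, div_mul_div_comm, one_mul]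
  rw [hf] at h1
  have hk0 := latticeIndex_pos hk
  have h2 : Summable fun v => cosetIm N z (e v) ^ s := by
    -- A single fibre of the double series is a nonzero multiple of the Epstein series, which
    -- therefore converges.
    have h := h1.summable.prod_factor 0
    have hne : 1 / (k 0 : ℝ) ^ (2 * s) ≠ 0 := by have := hk0 0; positivity
    exact (summable_mul_left_iff hne).1 h
  refine ⟨e.summable_iff.1 h2, ?_⟩
  have h3 := summable_one_div_latticeIndex_pow hk (s := 2 * s) (by omega)
  rw [← h1.tsum_eq, ← e.tsum_eq]
  refine (tsum_mul_tsum_of_summable_norm h3.norm h2.norm).symm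

/-! ### The lattices of levels 1 and 4. -/

theorem isRowSelector_one :
    IsRowSelector 1 (fun n => n + 1) fun v => 0 < v.1 ∨ v.1 = 0 ∧ 0 < v.2 where
  dvd v _ := by simp
  or_neg v hv _ := by
    rcases lt_trichotomy v.1 0 with h | h | h
    · right; left; simpa using h
    · have h2 : v.2 ≠ 0 := by
        intro h2
        rw [h, h2] at hv
        exact not_isCoprime_zero_zero hv
      rcases lt_or_gt_of_ne h2 with h3 | h3
      · right; right; simpa using ⟨h, h3⟩
      · left; right; exact ⟨h, h3⟩
    · left; left; exact h
  not_neg v hv := by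
    simp only [Prod.fst_neg, Prod.snd_neg]
    omega
  mul_iff g v hg _ := by
    have hg' : (0 : ℤ) < g := by exact_mod_cast hg
    have hr : g ∈ Set.range fun n : ℕ => n + 1 := ⟨g - 1, by simp only; omega⟩
    simp [hr, hg, hg.ne']

/-- In a coprime row with `4 ∣ c` the entry `d` is odd, hence nonzero, and its sign picks the
representative. Odd `d` also forces an odd multiplier `g`, which is prime to `4`. -/
theorem isRowSelector_four :
    IsRowSelector 4 (fun n => 2 * n + 1) fun v => 4 ∣ v.1 ∧ 0 < v.2 ∧ Odd v.2 where
  dvd v hv := by exact_mod_cast hv.1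
  or_neg v hv h4 := by
    have h4' : (4 : ℤ) ∣ v.1 := by exact_mod_cast h4
    have hodd : Odd v.2 := by
      rw [← Int.not_even_iff_odd]
      intro he
      have h2 : (2 : ℤ) ∣ v.1 := dvd_trans (by norm_num) h4'
      have := hv.isUnit_of_dvd' h2 he.two_dvd
      rw [Int.isUnit_iff] at this
      omega
    have h0 : v.2 ≠ 0 := by
      rintro h
      rw [h] at hodd
      exact absurd hodd (by decide)
    rcases lt_or_gt_of_ne h0 with h | h
    · right
      exact ⟨by simpa using h4', by simpa using h, by simpa using hodd⟩
    · exact Or.inl ⟨h4', h, hodd⟩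
  not_neg v hv := by
    simp only [Prod.fst_neg, Prod.snd_neg]
    omega
  mul_iff g v hg _ := by
    have hg' : (0 : ℤ) < g := by exact_mod_cast hg
    have hr : g ∈ Set.range (fun n : ℕ => 2 * n + 1) ↔ Odd g := by
      constructor
      · rintro ⟨n, rfl⟩; exact ⟨n, rfl⟩
      · rintro ⟨n, rfl⟩; exact ⟨n, rfl⟩
    rw [hr, Int.odd_mul, Int.odd_coe_nat]
    have hpos : 0 < (g : ℤ) * v.2 ↔ 0 < v.2 := by simp [hg]
    simp only [hpos]
    constructor
    · rintro ⟨h1, h2, h3, h4⟩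
      refine ⟨h3, ?_, h2, h4⟩
      have hc : IsCoprime (4 : ℤ) g := by
        have h2g : Nat.Coprime 2 g := (Nat.coprime_two_left).2 h3
        have := Nat.Coprime.pow_left 2 h2g
        exact_mod_cast Nat.isCoprime_iff_coprime.2 this
      exact hc.dvd_of_dvd_mul_left h1
    · rintro ⟨h3, h1, h2, h4⟩
      exact ⟨Dvd.dvd.mul_left h1 _, h2, h3, h4⟩

theorem latticeTerm_diag {k : ℕ → ℕ} (hk : ∀ n, n + 1 ≤ k n) (m : ℕ) (z : ℂ) (p : ℕ × ℤ) :
    latticeTerm k m z.re m p z.im = 1 / (Complex.normSq ((k p.1 : ℂ) * z + (p.2 : ℂ))) ^ (m + 1) := by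
  have h := latticeIndex_pos hk p.1
  rw [latticeTerm, div_self (by positivity), one_mul, Complex.normSq_apply]
  simp [sq]

theorem summable_one_div_add_one_pow {s : ℕ} (hs : 2 ≤ s) :
    Summable fun n : ℕ => 1 / ((n + 1 : ℕ) : ℝ) ^ s :=
  summable_one_div_latticeIndex_pow (k := fun n => n + 1) (fun _ => le_rfl) hs

/-- Rows with `c > 0` give the lattice sum; rows `(0, d)` give the zeta value that becomes the term
`y^(m+1)` after division. -/
theorem hasSum_lattice_one {m : ℕ} (hm : 1 ≤ m) (z : ℍ) :
    HasSum (fun w : {w : ℤ × ℤ // 0 < w.1 ∨ w.1 = 0 ∧ 0 < w.2} =>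
      (z.im / Complex.normSq ((w.1.1 : ℂ) * z + (w.1.2 : ℂ))) ^ (m + 1))
      (z.im ^ (m + 1) * (latticeSum (fun n => n + 1) m z.re m z.im +
        ∑' n : ℕ, 1 / ((n + 1 : ℕ) : ℝ) ^ (2 * (m + 1)))) := by
  have hk : ∀ n, n + 1 ≤ (fun n : ℕ => n + 1) n := fun n => le_rfl
  let φ : (ℕ × ℤ) ⊕ ℕ → {w : ℤ × ℤ // 0 < w.1 ∨ w.1 = 0 ∧ 0 < w.2} :=
    Sum.elim (fun p => ⟨((p.1 : ℤ) + 1, p.2), Or.inl (by simp only; omega)⟩)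
      (fun n => ⟨(0, (n : ℤ) + 1), Or.inr ⟨rfl, by simp only; omega⟩⟩)
  have hφ : Function.Bijective φ := by
    constructor
    · rintro (⟨a, b⟩ | a) (⟨c, d⟩ | c) h <;>
        have h1 := congrArg (fun w => w.1.1) h <;> have h2 := congrArg (fun w => w.1.2) h <;>
        simp only [φ, Sum.elim_inl, Sum.elim_inr] at h1 h2
      · have h3 : a = c := by omega
        rw [h3, h2]
      · omega
      · omega
      · have h3 : a = c := by omega
        rw [h3]
    · rintro ⟨⟨a, b⟩, h⟩
      simp only at h
      rcases h with h | ⟨h, h'⟩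
      · exact ⟨Sum.inl ((a - 1).toNat, b), Subtype.ext (Prod.ext (by simp [φ]; omega) rfl)⟩
      · exact ⟨Sum.inr (b - 1).toNat, Subtype.ext (Prod.ext h.symm (by simp [φ]; omega))⟩
  have h1 := (summable_latticeTerm hk hm z.re m z.im_pos).hasSum.mul_left (z.im ^ (m + 1))
  have h2 := (summable_one_div_add_one_pow
    (s := 2 * (m + 1)) (by omega)).hasSum.mul_left (z.im ^ (m + 1))
  refine (Equiv.ofBijective φ hφ).hasSum_iff.1 ?_
  rw [mul_add]
  have e1 : (fun p => z.im ^ (m + 1) * latticeTerm (fun n => n + 1) m z.re m p z.im) =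
      ((fun w : {w : ℤ × ℤ // 0 < w.1 ∨ w.1 = 0 ∧ 0 < w.2} =>
        (z.im / Complex.normSq ((w.1.1 : ℂ) * z + (w.1.2 : ℂ))) ^ (m + 1)) ∘ φ) ∘ Sum.inl := by
    funext p
    have h := latticeTerm_diag hk m z p
    rw [UpperHalfPlane.coe_re, UpperHalfPlane.coe_im] at h
    rw [h, mul_one_div, ← div_pow]
    simp [φ]
  have e2 : (fun n : ℕ => z.im ^ (m + 1) * (1 / ((n + 1 : ℕ) : ℝ) ^ (2 * (m + 1)))) =
      ((fun w : {w : ℤ × ℤ // 0 < w.1 ∨ w.1 = 0 ∧ 0 < w.2} =>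
        (z.im / Complex.normSq ((w.1.1 : ℂ) * z + (w.1.2 : ℂ))) ^ (m + 1)) ∘ φ) ∘ Sum.inr := by
    funext n
    change _ = (z.im / Complex.normSq (((0 : ℤ) : ℂ) * z + (((n : ℤ) + 1 : ℤ) : ℂ))) ^ (m + 1)
    rw [Int.cast_zero, zero_mul, zero_add, show (((n : ℤ) + 1 : ℤ) : ℂ) = ((n + 1 : ℕ) : ℂ) by simp,
      Complex.normSq_natCast, div_pow, ← sq, ← pow_mul, mul_one_div]
  rw [e1] at h1
  rw [e2] at h2
  exact h1.sum h2

theorem negInvFourMul_im (z : ℍ) :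
    (negInvFourMul z).im = z.im / (4 * Complex.normSq (z : ℂ)) := by
  have h : Complex.normSq (z : ℂ) ≠ 0 := z.normSq_ne_zero
  change (-1 / (4 * (z : ℂ))).im = _
  rw [div_eq_mul_inv, neg_one_mul, Complex.neg_im, Complex.inv_im, Complex.normSq_mul,
    Complex.normSq_ofNat]
  simp
  field_simp

/-- With `w = -1/(4z)` one has `-4 c w + d = (d z + c) / z`, and `|z|^2` cancels against `Im w`. The
entries swap roles: the odd `d` becomes the multiplier of `z`. -/
theorem im_negInvFourMul_div_normSq (z : ℍ) (c d : ℂ) :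
    (negInvFourMul z).im / Complex.normSq (-4 * c * (negInvFourMul z : ℂ) + d) =
      z.im / 4 / Complex.normSq (d * z + c) := by
  have h : Complex.normSq (z : ℂ) ≠ 0 := z.normSq_ne_zero
  have h0 : (z : ℂ) ≠ 0 := z.ne_zero
  have h1 : -4 * c * (negInvFourMul z : ℂ) + d = (d * z + c) / z := by
    change -4 * c * (-1 / (4 * (z : ℂ))) + d = _
    field_simp
    ring
  rw [h1, Complex.normSq_div, negInvFourMul_im]
  field_simp

theorem hasSum_lattice_four {m : ℕ} (hm : 1 ≤ m) (z : ℍ) :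
    HasSum (fun w : {w : ℤ × ℤ // 4 ∣ w.1 ∧ 0 < w.2 ∧ Odd w.2} =>
      ((negInvFourMul z).im /
        Complex.normSq ((w.1.1 : ℂ) * (negInvFourMul z : ℂ) + (w.1.2 : ℂ))) ^ (m + 1))
      ((z.im / 4) ^ (m + 1) * latticeSum (fun n => 2 * n + 1) m z.re m z.im) := by
  have hk : ∀ n, n + 1 ≤ (fun n : ℕ => 2 * n + 1) n := fun n => by simp only; omega
  let φ : ℕ × ℤ → {w : ℤ × ℤ // 4 ∣ w.1 ∧ 0 < w.2 ∧ Odd w.2} :=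
    fun p => ⟨(-4 * p.2, 2 * (p.1 : ℤ) + 1), ⟨-p.2, by simp⟩, by simp only; omega, ⟨p.1, rfl⟩⟩
  have hφ : Function.Bijective φ := by
    constructor
    · rintro ⟨a, b⟩ ⟨c, d⟩ h
      have h1 := congrArg (fun w => w.1.1) h
      have h2 := congrArg (fun w => w.1.2) h
      simp only [φ] at h1 h2
      exact Prod.ext (by simp only; omega) (by simp only; omega)
    · rintro ⟨⟨a, b⟩, ⟨c, hc⟩, hb, ⟨n, hn⟩⟩
      simp only at hc hb hn
      refine ⟨(n.toNat, -c), Subtype.ext (Prod.ext ?_ ?_)⟩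
      · simp [φ, hc]
      · simp only [φ]
        omega
  have h1 := (summable_latticeTerm hk hm z.re m z.im_pos).hasSum.mul_left ((z.im / 4) ^ (m + 1))
  refine (Equiv.ofBijective φ hφ).hasSum_iff.1 ?_
  have e1 : (fun p => (z.im / 4) ^ (m + 1) * latticeTerm (fun n => 2 * n + 1) m z.re m p z.im) =
      (fun w : {w : ℤ × ℤ // 4 ∣ w.1 ∧ 0 < w.2 ∧ Odd w.2} => ((negInvFourMul z).im /
        Complex.normSq ((w.1.1 : ℂ) * (negInvFourMul z : ℂ) + (w.1.2 : ℂ))) ^ (m + 1)) ∘ φ := by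
    funext p
    have h := latticeTerm_diag hk m z p
    rw [UpperHalfPlane.coe_re, UpperHalfPlane.coe_im] at h
    rw [h, mul_one_div, ← div_pow, ← im_negInvFourMul_div_normSq]
    simp [φ]
  rw [e1] at h1
  exact h1

/-! ### Zeta values, the original series and the final formulas. -/

theorem epsteinTerm_natCast_add_one (N : ℕ) (z : ℍ) (m : ℕ) :
    epsteinTerm N z (m + 1) = fun γ => ((cosetIm N z γ ^ (m + 1) : ℝ) : ℂ) := by
  funext γ
  rw [epsteinTerm, ← Nat.cast_add_one, Complex.cpow_natCast, Complex.ofReal_pow]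

theorem riemannZeta_eq_ofReal_tsum {s : ℕ} (hs : 2 ≤ s) :
    riemannZeta s = ((∑' n : ℕ, 1 / ((n + 1 : ℕ) : ℝ) ^ s : ℝ) : ℂ) := by
  rw [zeta_eq_tsum_one_div_nat_add_one_cpow (by simpa using (show 1 < s by omega)), Complex.ofReal_tsum]
  refine tsum_congr fun n => ?_
  rw [Complex.cpow_natCast]
  push_cast
  rfl

theorem two_pow_mul_tsum_odd {s : ℕ} (hs : 2 ≤ s) :
    (2 : ℝ) ^ s * ∑' n : ℕ, 1 / ((2 * n + 1 : ℕ) : ℝ) ^ s =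
      (2 ^ s - 1) * ∑' n : ℕ, 1 / ((n + 1 : ℕ) : ℝ) ^ s := by
  have hsum : Summable fun n : ℕ => 1 / (n : ℝ) ^ s :=
    Real.summable_one_div_nat_pow.2 (by omega)
  have h1 := tsum_even_add_odd (f := fun n : ℕ => 1 / (n : ℝ) ^ s)
    (hsum.comp_injective fun a b h => by simpa using h)
    (hsum.comp_injective fun a b h => by simpa using h)
  have h2 := hsum.tsum_eq_zero_add
  have h3 : ∑' n : ℕ, 1 / ((2 * n : ℕ) : ℝ) ^ s = 1 / 2 ^ s * ∑' n : ℕ, 1 / (n : ℝ) ^ s := by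
    rw [← tsum_mul_left]
    refine tsum_congr fun n => ?_
    push_cast
    rw [mul_pow]
    ring
  rw [h3, h2] at h1
  have h0 : (1 : ℝ) / ((0 : ℕ) : ℝ) ^ s = 0 := by
    rw [Nat.cast_zero, zero_pow (by omega), div_zero]
  rw [h0, zero_add] at h1
  have h2s : (2 : ℝ) ^ s ≠ 0 := by positivity
  field_simp at h1
  linarith

theorem ramanujanTermOne_add_one (m : ℕ) (z : ℂ) (n : ℕ) :
    ramanujanTermOne m z (n + 1) = lambertTerm (fun n => n + 1) m z n := by
  rw [ramanujanTermOne, lambertTerm, Complex.div_I]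
  congr 4
  push_cast
  ring

/-- The shift in `2z + 1` contributes `exp ((2n+1) π / i) = -1`, which turns `E + 1` into `-(E -
1)`. -/
theorem ramanujanTermFour_eq (m : ℕ) (z : ℂ) (n : ℕ) :
    ramanujanTermFour m z n = -lambertTerm (fun n => 2 * n + 1) m z n := by
  have h : (2 * n + 1 : ℂ) * Real.pi * ((2 * z + 1) / Complex.I) =
      -(2 * Real.pi * Complex.I * ((2 * n + 1 : ℕ) * z)) + Real.pi * Complex.I +
        ((-(n + 1 : ℤ) : ℤ) : ℂ) * (2 * Real.pi * Complex.I) := by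
    rw [Complex.div_I]
    push_cast
    ring
  rw [ramanujanTermFour, lambertTerm, h, Complex.exp_add, Complex.exp_int_mul_two_pi_mul_I,
    mul_one, Complex.exp_add, Complex.exp_pi_mul_I]
  generalize Complex.exp (-(2 * Real.pi * Complex.I * ((2 * n + 1 : ℕ) * z))) = E
  rw [show E * -1 + 1 = -(E - 1) by ring, div_neg, mul_neg]
  push_cast
  rfl

theorem iterate_derivInv_neg (f : ℝ → ℝ) (j : ℕ) :
    derivInv^[j] (fun y => -f y) = fun y => -derivInv^[j] f y := by
  induction j with
  | zero => rfl
  | succ j ih =>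
    rw [Function.iterate_succ_apply', Function.iterate_succ_apply', ih]
    funext y
    simp only [derivInv, mul_neg, deriv.fun_neg]

/-- The level `1` formula over the reals. -/
theorem summable_and_tsum_cosetIm_one {m : ℕ} (hm : 1 ≤ m) (z : ℍ) :
    Summable (fun γ => cosetIm 1 z γ ^ (m + 1)) ∧
      ∑' γ, cosetIm 1 z γ ^ (m + 1) = z.im ^ (m + 1) +
        (√Real.pi * Real.Gamma (m + 1 / 2) / m.factorial) *
          ((∑' n : ℕ, 1 / ((n + 1 : ℕ) : ℝ) ^ (2 * m + 1)) /
            ∑' n : ℕ, 1 / ((n + 1 : ℕ) : ℝ) ^ (2 * m + 2)) * (1 / z.im ^ m) -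
        (Real.pi * z.im ^ m /
          ((-2) ^ (m - 1) * m.factorial * ∑' n : ℕ, 1 / ((n + 1 : ℕ) : ℝ) ^ (2 * m + 2))) *
          derivInv^[m] (fun y : ℝ =>
            (∑' n, lambertTerm (fun n => n + 1) m (z.re + y * Complex.I) n).re) z.im := by
  have hk : ∀ n, n + 1 ≤ (fun n : ℕ => n + 1) n := fun n => le_rfl
  obtain ⟨h1, h2⟩ := isRowSelector_one.summable_and_tsum_eq hk (add_left_injective 1) z (m + 1)
    (by omega) (hasSum_lattice_one hm z)
  refine ⟨h1, ?_⟩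
  rw [iterate_derivInv_re_tsum_lambertTerm hk hm z.re m z.im_pos]
  have hZ := (summable_one_div_add_one_pow (s := 2 * (m + 1)) (by omega)).tsum_pos
    (fun n => by positivity) 0 (by norm_num)
  have hy := z.im_pos
  have hr : 0 < √Real.pi := Real.sqrt_pos.2 Real.pi_pos
  have hπ : Real.pi = √Real.pi ^ 2 := (Real.sq_sqrt Real.pi_pos.le).symm
  rw [show 2 * m + 2 = 2 * (m + 1) by ring]
  generalize (∑' n : ℕ, 1 / ((n + 1 : ℕ) : ℝ) ^ (2 * (m + 1))) = Z at h2 hZ ⊢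
  generalize (∑' γ, cosetIm 1 z γ ^ (m + 1)) = S at h2 ⊢
  generalize (∑' n : ℕ, 1 / ((n + 1 : ℕ) : ℝ) ^ (2 * m + 1)) = Z'
  generalize latticeSum (fun n => n + 1) m z.re m z.im = H at h2 ⊢
  rw [show S = z.im ^ (m + 1) * (H + Z) / Z by rw [h2]; field_simp]
  -- Substituting `m = j + 1` removes the truncated subtraction in `(-2) ^ (m - 1)`.
  obtain ⟨j, rfl⟩ := Nat.exists_eq_add_of_le' hm
  have hf : (0 : ℝ) < (j + 1).factorial := by positivity
  generalize ((j + 1).factorial : ℝ) = F at hf ⊢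
  generalize Real.Gamma ((j + 1 : ℕ) + 1 / 2) = G
  rw [hπ, Real.sqrt_sq hr.le]
  generalize √Real.pi = r at hr ⊢
  generalize z.im = y at hy ⊢
  simp only [add_tsub_cancel_right]
  field_simp
  ring

/-- The level `4` formula over the reals. -/
theorem summable_and_tsum_cosetIm_four {m : ℕ} (hm : 1 ≤ m) (z : ℍ) :
    Summable (fun γ => cosetIm 4 (negInvFourMul z) γ ^ (m + 1)) ∧
      ∑' γ, cosetIm 4 (negInvFourMul z) γ ^ (m + 1) =
        ((2 ^ (2 * m + 1) - 1) / (2 ^ (2 * m + 2) - 1)) *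
          (√Real.pi * Real.Gamma (m + 1 / 2) / (2 * m.factorial)) *
          ((∑' n : ℕ, 1 / ((n + 1 : ℕ) : ℝ) ^ (2 * m + 1)) /
            ∑' n : ℕ, 1 / ((n + 1 : ℕ) : ℝ) ^ (2 * m + 2)) * (1 / (4 * z.im) ^ m) +
        (Real.pi * z.im ^ m /
          ((-2) ^ (m - 1) * (2 ^ (2 * m + 2) - 1) * m.factorial *
            ∑' n : ℕ, 1 / ((n + 1 : ℕ) : ℝ) ^ (2 * m + 2))) *
          derivInv^[m] (fun y : ℝ =>
            -(∑' n, lambertTerm (fun n => 2 * n + 1) m (z.re + y * Complex.I) n).re) z.im := by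
  have hk : ∀ n, n + 1 ≤ (fun n : ℕ => 2 * n + 1) n := fun n => by simp only; omega
  obtain ⟨h1, h2⟩ := isRowSelector_four.summable_and_tsum_eq hk
    (fun a b h => by simpa using h) (negInvFourMul z) (m + 1) (by omega) (hasSum_lattice_four hm z)
  refine ⟨h1, ?_⟩
  rw [iterate_derivInv_neg]
  simp only
  rw [iterate_derivInv_re_tsum_lambertTerm hk hm z.re m z.im_pos]
  have hZ := (summable_one_div_add_one_pow (s := 2 * m + 2) (by omega)).tsum_pos
    (fun n => by positivity) 0 (by norm_num)
  have hO := two_pow_mul_tsum_odd (s := 2 * m + 2) (by omega)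
  have hO' := two_pow_mul_tsum_odd (s := 2 * m + 1) (by omega)
  have hy := z.im_pos
  have hr : 0 < √Real.pi := Real.sqrt_pos.2 Real.pi_pos
  have hπ : Real.pi = √Real.pi ^ 2 := (Real.sq_sqrt Real.pi_pos.le).symm
  rw [show 2 * (m + 1) = 2 * m + 2 by ring] at h2
  generalize (∑' n : ℕ, 1 / ((n + 1 : ℕ) : ℝ) ^ (2 * m + 2)) = Z at hO hZ ⊢
  generalize (∑' γ, cosetIm 4 (negInvFourMul z) γ ^ (m + 1)) = S at h2 ⊢
  generalize (∑' n : ℕ, 1 / ((n + 1 : ℕ) : ℝ) ^ (2 * m + 1)) = Z' at hO' ⊢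
  generalize (∑' n : ℕ, 1 / ((2 * n + 1 : ℕ) : ℝ) ^ (2 * m + 2)) = O at hO h2
  generalize (∑' n : ℕ, 1 / ((2 * n + 1 : ℕ) : ℝ) ^ (2 * m + 1)) = O' at hO' ⊢
  generalize latticeSum (fun n => 2 * n + 1) m z.re m z.im = H at h2 ⊢
  have hp1 : (2 : ℝ) ^ (2 * m + 1) = 2 * 4 ^ m := by rw [pow_succ, pow_mul]; norm_num; ring
  have hp2 : (2 : ℝ) ^ (2 * m + 2) = 4 * 4 ^ m := by rw [pow_add, pow_mul]; norm_num; ring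
  have h4 : (1 : ℝ) ≤ 4 ^ m := one_le_pow₀ (by norm_num)
  rw [hp1] at hO' ⊢
  rw [hp2] at hO ⊢
  have hden : (0 : ℝ) < 4 * 4 ^ m - 1 := by linarith
  have hOe : O = (4 * 4 ^ m - 1) * Z / (4 * 4 ^ m) := by rw [← hO]; field_simp
  have hOe' : O' = (2 * 4 ^ m - 1) * Z' / (2 * 4 ^ m) := by rw [← hO']; field_simp
  have hOpos : 0 < O := by rw [hOe]; positivity
  rw [show S = (z.im / 4) ^ (m + 1) * H / O by rw [h2]; field_simp]
  rw [hOe, hOe', mul_pow, div_pow, pow_succ 4 m]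
  obtain ⟨j, rfl⟩ := Nat.exists_eq_add_of_le' hm
  generalize (4 : ℝ) ^ (j + 1) = q at h4 hden ⊢
  have hf : (0 : ℝ) < (j + 1).factorial := by positivity
  generalize ((j + 1).factorial : ℝ) = F at hf ⊢
  generalize Real.Gamma ((j + 1 : ℕ) + 1 / 2) = G
  rw [hπ, Real.sqrt_sq hr.le]
  generalize √Real.pi = r at hr ⊢
  generalize z.im = y at hy ⊢
  simp only [add_tsub_cancel_right]
  have hq : 0 < q := by linarith
  have hden' := hden.ne'
  field_simp
  ring

theorem isBigO_of_norm_le {f : ℕ → ℂ} {g : ℕ → ℝ} (C : ℝ) (hg : ∀ n, 0 ≤ g n)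
    (h : ∀ n, 1 ≤ n → ‖f n‖ ≤ C * g n) : f =O[Filter.atTop] g := by
  refine Asymptotics.IsBigO.of_bound C ?_
  filter_upwards [Filter.eventually_ge_atTop 1] with n hn
  rw [Real.norm_of_nonneg (hg n)]
  exact h n hn

theorem theorem1 (m : ℕ) (hm : 1 ≤ m) (z : ℍ) :
    -- (a) level 1
    (Summable (epsteinTerm 1 z (m + 1)) ∧
      (fun n : ℕ => ramanujanTermOne m z n) =O[Filter.atTop]
        (fun n : ℕ => Real.exp (-(2 * Real.pi * n * z.im))) ∧
      ContDiffOn ℝ ∞ (ramanujanSumOne m z.re) (Set.Ioi 0) ∧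
      epsteinZeta 1 z (m + 1) =
        (z.im : ℂ) ^ (m + 1)
        + (Real.sqrt Real.pi * Complex.Gamma (m + 1 / 2) / Complex.Gamma (m + 1))
          * (riemannZeta (2 * m + 1) / riemannZeta (2 * m + 2)) * (1 / (z.im : ℂ) ^ m)
        - (Real.pi * (z.im : ℂ) ^ m
            / ((-2) ^ (m - 1) * Complex.Gamma (m + 1) * riemannZeta (2 * m + 2)))
          * ((derivInv^[m] (ramanujanSumOne m z.re) z.im : ℝ) : ℂ)) ∧
    -- (b) level 4
    (Summable (epsteinTerm 4 (negInvFourMul z) (m + 1)) ∧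
      (fun n : ℕ => ramanujanTermFour m z n) =O[Filter.atTop]
        (fun n : ℕ => Real.exp (-(2 * Real.pi * (2 * n + 1) * z.im))) ∧
      ContDiffOn ℝ ∞ (ramanujanSumFour m z.re) (Set.Ioi 0) ∧
      epsteinZeta 4 (negInvFourMul z) (m + 1) =
        ((2 ^ (2 * m + 1) - 1) / (2 ^ (2 * m + 2) - 1))
          * (Real.sqrt Real.pi * Complex.Gamma (m + 1 / 2) / (2 * Complex.Gamma (m + 1)))
          * (riemannZeta (2 * m + 1) / riemannZeta (2 * m + 2)) * (1 / (4 * (z.im : ℂ)) ^ m)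
        + (Real.pi * (z.im : ℂ) ^ m
            / ((-2) ^ (m - 1) * (2 ^ (2 * m + 2) - 1) * Complex.Gamma (m + 1)
              * riemannZeta (2 * m + 2)))
          * ((derivInv^[m] (ramanujanSumFour m z.re) z.im : ℝ) : ℂ)) := by
  have hk1 : ∀ n, n + 1 ≤ (fun n : ℕ => n + 1) n := fun n => le_rfl
  have hk4 : ∀ n, n + 1 ≤ (fun n : ℕ => 2 * n + 1) n := fun n => by simp only; omega
  have hy := z.im_pos
  have hπ := Real.pi_pos
  have hS1 : ramanujanSumOne m z.re = fun y : ℝ =>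
      (∑' n, lambertTerm (fun n => n + 1) m (z.re + y * Complex.I) n).re := by
    funext y
    simp only [ramanujanSumOne, ramanujanTermOne_add_one]
  have hS4 : ramanujanSumFour m z.re = fun y : ℝ =>
      -(∑' n, lambertTerm (fun n => 2 * n + 1) m (z.re + y * Complex.I) n).re := by
    funext y
    simp only [ramanujanSumFour, ramanujanTermFour_eq, tsum_neg, Complex.neg_re]
  have hΓ1 : Complex.Gamma (m + 1) = ((m.factorial : ℝ) : ℂ) := by
    rw [Complex.Gamma_nat_eq_factorial, Complex.ofReal_natCast]
  have hΓ2 : Complex.Gamma (m + 1 / 2) = ((Real.Gamma (m + 1 / 2) : ℝ) : ℂ) := by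
    rw [← Complex.Gamma_ofReal]
    push_cast
    rfl
  have hζ1 : riemannZeta (2 * m + 1) =
      ((∑' n : ℕ, 1 / ((n + 1 : ℕ) : ℝ) ^ (2 * m + 1) : ℝ) : ℂ) := by
    rw [← riemannZeta_eq_ofReal_tsum (by omega)]
    push_cast
    rfl
  have hζ2 : riemannZeta (2 * m + 2) =
      ((∑' n : ℕ, 1 / ((n + 1 : ℕ) : ℝ) ^ (2 * m + 2) : ℝ) : ℂ) := by
    rw [← riemannZeta_eq_ofReal_tsum (by omega)]
    push_cast
    rfl
  obtain ⟨hs1, ht1⟩ := summable_and_tsum_cosetIm_one hm z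
  obtain ⟨hs4, ht4⟩ := summable_and_tsum_cosetIm_four hm z
  refine ⟨⟨?_, ?_, ?_, ?_⟩, ?_, ?_, ?_, ?_⟩
  · rw [epsteinTerm_natCast_add_one]
    exact Complex.ofRealCLM.summable hs1
  · refine isBigO_of_norm_le (1 / (1 - Real.exp (-(2 * Real.pi * z.im))))
      (fun n => (Real.exp_pos _).le) fun n hn => ?_
    -- The level 1 series starts at `n = 1`, so its term `j + 1` is the Lambert term of index `j`.
    obtain ⟨j, rfl⟩ := Nat.exists_eq_add_of_le' hn
    rw [ramanujanTermOne_add_one]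
    have := norm_lambertTerm_le_exp hk1 (m := m) (z := z) hy j
    rwa [← mul_assoc] at this
  · rw [hS1]
    exact contDiffOn_re_tsum_lambertTerm hk1 hm z.re
  · rw [epsteinZeta, epsteinTerm_natCast_add_one, ← Complex.ofReal_tsum, ht1, hS1, hΓ1, hΓ2, hζ1,
      hζ2]
    push_cast
    rfl
  · rw [epsteinTerm_natCast_add_one]
    exact Complex.ofRealCLM.summable hs4
  · refine isBigO_of_norm_le (1 / (1 - Real.exp (-(2 * Real.pi * z.im))))
      (fun n => (Real.exp_pos _).le) fun n _ => ?_
    rw [ramanujanTermFour_eq, norm_neg]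
    have := norm_lambertTerm_le_exp hk4 (m := m) (z := z) hy n
    rw [← mul_assoc] at this
    exact_mod_cast this
  · rw [hS4]
    exact (contDiffOn_re_tsum_lambertTerm hk4 hm z.re).neg
  · rw [epsteinZeta, epsteinTerm_natCast_add_one, ← Complex.ofReal_tsum, ht4, hS4, hΓ1, hΓ2, hζ1,
      hζ2]
    push_cast
    rfl
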